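/- Let $\kappa\in\mathbb R$, $d,n\in\mathbb N$, and let $\mathfrak{st}_\kappa^d=\{x\in\mathbb R^d : -\kappa\|x\|^2<1\}$ with the Riemannian metric $(\lambda_x^\kappa)^2\langle\cdot,\cdot\rangle$, $\lambda_x^\kappa=\frac{2}{1+\kappa\|x\|^2}$ (hyperbolic space for $\kappa<0$, $\mathbb R^d$ with its Euclidean metric scaled by $4$ for $\kappa=0$, the stereographic image of the sphere of curvature $\kappa$ minus one point for $\kappa>0$). Put $$x\oplus_\kappa y=\frac{(1-2\kappa\langle x,y\rangle-\kappa\|y\|^2)x+(1+\kappa\|x\|^2)y}{1-2\kappa\langle x,y\rangle+\kappa^2\|x\|^2\|y\|^2}.$$ Let $\cos_\kappa(r)$ be $\cos(\sqrt\kappa r)$, $1$, $\cosh(\sqrt{-\kappa}r)$, let $\sin_\kappa(r)$ be $\frac{\sin(\sqrt\kappa r)}{\sqrt\kappa}$, $r$, $\frac{\sinh(\sqrt{-\kappa}r)}{\sqrt{-\kappa}}$, and let $\arctan_\kappa(u)$ be $\frac{\arctan(\sqrt\kappa u)}{\sqrt\kappa}$, $u$, $\frac{\operatorname{artanh}(\sqrt{-\kappa}u)}{\sqrt{-\kappa}}$,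 for $\kappa>0$, $\kappa=0$, $\kappa<0$ respectively. The distance is $d_\kappa(x,y)=2\arctan_\kappa\|(-x)\oplus_\kappa y\|$ (and $\pi/\sqrt\kappa$ if $(-x)\oplus_\kappa y$ is undefined, which happens only for antipodal points when $\kappa>0$). The logarithmic and exponential maps are $$\log_x^\kappa(y)=\frac{2}{\lambda_x^\kappa}\arctan_\kappa(\|w\|)\frac{w}{\|w\|},\quad w=(-x)\oplus_\kappa y,\qquad \exp_x^\kappa(v)=\frac{\lambda_x^\kappa\bigl(\cos_\kappa r-\kappa\langle x,u\rangle\sin_\kappa r\bigr)x+(\sin_\kappa r)\,u}{1+(\lambda_x^\kappa-1)\cos_\kappa r-\kappa\lambda_x^\kappa\langle x,u\rangle\sin_\kappa r},\quad u=\frac{v}{\|v\|},\ r=\lambda_x^\kappa\|v\|,$$ with $\log_x^\kappa(x)=0$ and $\exp_x^\kappa(0)=x$. For points $x,x_1,\dots,x_n$ and weights $\alpha_1,\dots,\alpha_n\in\mathbb R$ the tangential aggregation is $$\mathfrak{tg}_x(\{x_i\};\{\alpha_i\})=\exp_x^\kappa\Bigl(\sum_{i=1}^n\alpha_i\log_x^\kappa(x_i)\Bigr);$$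 it is called defined if the denominators of all the $(-x)\oplus_\kappa x_i$ and of $\exp_x^\kappa$ at $\sum_i\alpha_i\log_x^\kappa(x_i)$ are nonzero. Let $\phi:S\to\mathfrak{st}_\kappa^d$ be an isometry of $\mathfrak{st}_\kappa^d$, that is, a map with $d_\kappa(\phi(y),\phi(z))=d_\kappa(y,z)$ for all $y,z\in S$, where $S=\mathfrak{st}_\kappa^d$ if $\kappa\le 0$, while for $\kappa>0$ the domain $S\subseteq\mathfrak{st}_\kappa^d$ may omit at most one point (as for an isometry of the sphere that moves the centre of projection). Let $x,x_1,\dots,x_n\in S$ and $\alpha_1,\dots,\alpha_n\in\mathbb R$. If $\kappa>0$, assume moreover that $\mathfrak{tg}_x(\{x_i\};\{\alpha_i\})$ is defined and lies in $S$. Then $\mathfrak{tg}_x(\{x_i\};\{\alpha_i\})$ is defined and lies in $S$ (also for $\kappa\le0$), $\mathfrak{tg}_{\phi(x)}(\{\phi(x_i)\};\{\alpha_i\})$ is defined, and $$\mathfrak{tg}_{\phi(x)}(\{\phi(x_i)\};\{\alpha_i\})=\phi\bigl(\mathfrak{tg}_x(\{x_i\};\{\alpha_i\})\bigr).$$ 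-/

import Mathlib

noncomputable section

namespace KStereo

/-- The underlying set of the `κ`-stereographic model `𝔰𝔱_κ^d` inside `ℝ^d`: all of `ℝ^d` if
`κ ≥ 0`, the open ball of radius `1 / √(-κ)` if `κ < 0`. -/
def st (κ : ℝ) (d : ℕ) : Set (EuclideanSpace ℝ (Fin d)) :=
  {x | -κ * ‖x‖ ^ 2 < 1}

/-- The conformal factor `λ_x^κ`; the Riemannian metric at `x` is `(λ_x^κ)²` times the
Euclidean one. -/
def conf {d : ℕ} (κ : ℝ) (x : EuclideanSpace ℝ (Fin d)) : ℝ :=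
  2 / (1 + κ * ‖x‖ ^ 2)

/-- The denominator of the `κ`-addition. -/
def addDen {d : ℕ} (κ : ℝ) (x y : EuclideanSpace ℝ (Fin d)) : ℝ :=
  1 - 2 * κ * inner ℝ x y + κ ^ 2 * ‖x‖ ^ 2 * ‖y‖ ^ 2

/-- The `κ`-addition `x ⊕_κ y`, meaningful where `addDen κ x y ≠ 0`. -/
def add {d : ℕ} (κ : ℝ) (x y : EuclideanSpace ℝ (Fin d)) : EuclideanSpace ℝ (Fin d) :=
  (addDen κ x y)⁻¹ •
    ((1 - 2 * κ * inner ℝ x y - κ * ‖y‖ ^ 2) • x + (1 + κ * ‖x‖ ^ 2) • y)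

/-- Generalized cosine: `cos (√κ r)`, `1`, `cosh (√(-κ) r)` for `κ > 0`, `κ = 0`, `κ < 0`. -/
def cosK (κ r : ℝ) : ℝ :=
  if 0 < κ then Real.cos (√κ * r) else if κ < 0 then Real.cosh (√(-κ) * r) else 1

/-- Generalized sine: `sin (√κ r) / √κ`, `r`, `sinh (√(-κ) r) / √(-κ)`. -/
def sinK (κ r : ℝ) : ℝ :=
  if 0 < κ then Real.sin (√κ * r) / √κ
  else if κ < 0 then Real.sinh (√(-κ) * r) / √(-κ) else r

/-- Generalized inverse tangent: `arctan (√κ u) / √κ`, `u`, `artanh (√(-κ) u) / √(-κ)`. -/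
def arctanK (κ u : ℝ) : ℝ :=
  if 0 < κ then Real.arctan (√κ * u) / √κ
  else if κ < 0 then Real.artanh (√(-κ) * u) / √(-κ) else u

/-- The distance `d_κ`. If `(-x) ⊕_κ y` is undefined (only possible for `κ > 0`), then `x` and `y`
represent antipodal points of the sphere, whose distance is `π / √κ`. -/
def kdist {d : ℕ} (κ : ℝ) (x y : EuclideanSpace ℝ (Fin d)) : ℝ :=
  if addDen κ (-x) y = 0 then Real.pi / √κ else 2 * arctanK κ ‖add κ (-x) y‖

/-- The logarithmic map `log_x^κ(y)`, meaningful where `(-x) ⊕_κ y` is defined. -/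
def logMap {d : ℕ} (κ : ℝ) (x y : EuclideanSpace ℝ (Fin d)) : EuclideanSpace ℝ (Fin d) :=
  (2 / conf κ x * arctanK κ ‖add κ (-x) y‖) • (‖add κ (-x) y‖⁻¹ • add κ (-x) y)

/-- The denominator of the exponential map. For `κ > 0` it vanishes exactly when the geodesic with
initial velocity `v` arrives at time one at the centre of projection of the sphere, which is
missing from the model; for `κ ≤ 0` it never vanishes. -/
def expDen {d : ℕ} (κ : ℝ) (x v : EuclideanSpace ℝ (Fin d)) : ℝ :=
  1 + (conf κ x - 1) * cosK κ (conf κ x * ‖v‖)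
    - κ * conf κ x * inner ℝ x (‖v‖⁻¹ • v) * sinK κ (conf κ x * ‖v‖)

/-- The exponential map `exp_x^κ(v)`, meaningful where `expDen κ x v ≠ 0`. -/
def expMap {d : ℕ} (κ : ℝ) (x v : EuclideanSpace ℝ (Fin d)) : EuclideanSpace ℝ (Fin d) :=
  (expDen κ x v)⁻¹ •
    ((conf κ x * (cosK κ (conf κ x * ‖v‖)
        - κ * inner ℝ x (‖v‖⁻¹ • v) * sinK κ (conf κ x * ‖v‖))) • x
      + sinK κ (conf κ x * ‖v‖) • (‖v‖⁻¹ • v))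

/-- The tangent vector `∑ αᵢ log_x^κ(xᵢ)`. -/
def tgVec {d n : ℕ} (κ : ℝ) (x : EuclideanSpace ℝ (Fin d))
    (xs : Fin n → EuclideanSpace ℝ (Fin d)) (α : Fin n → ℝ) : EuclideanSpace ℝ (Fin d) :=
  ∑ i, α i • logMap κ x (xs i)

/-- Tangential aggregation `𝔱𝔤_x({xᵢ}; {αᵢ}) = exp_x^κ(∑ αᵢ log_x^κ(xᵢ))`. -/
def tg {d n : ℕ} (κ : ℝ) (x : EuclideanSpace ℝ (Fin d))
    (xs : Fin n → EuclideanSpace ℝ (Fin d)) (α : Fin n → ℝ) : EuclideanSpace ℝ (Fin d) :=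
  expMap κ x (tgVec κ x xs α)

/-- All logarithms and the exponential in the tangential aggregation are defined. -/
def TgDefined {d n : ℕ} (κ : ℝ) (x : EuclideanSpace ℝ (Fin d))
    (xs : Fin n → EuclideanSpace ℝ (Fin d)) (α : Fin n → ℝ) : Prop :=
  (∀ i, addDen κ (-x) (xs i) ≠ 0) ∧ expDen κ x (tgVec κ x xs α) ≠ 0

/-- `φ`, with domain `S`, is an isometry of `𝔰𝔱_κ^d`. For `κ ≤ 0` the domain is the whole space.
For `κ > 0` the model is a sphere with one point removed; an isometry of the sphere that moves the
removed point is undefined at one point of the model, so one point may be missing from `S`. -/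
structure IsIsom {d : ℕ} (κ : ℝ) (S : Set (EuclideanSpace ℝ (Fin d)))
    (φ : EuclideanSpace ℝ (Fin d) → EuclideanSpace ℝ (Fin d)) : Prop where
  subset : S ⊆ st κ d
  whole : κ ≤ 0 → S = st κ d
  missing : (st κ d \ S).Subsingleton
  mapsTo : Set.MapsTo φ S (st κ d)
  dist_eq : ∀ x ∈ S, ∀ y ∈ S, kdist κ (φ x) (φ y) = kdist κ x y

theorem cosK_sq (κ r : ℝ) : cosK κ r ^ 2 + κ * sinK κ r ^ 2 = 1 := by
  unfold cosK sinK
  split_ifs with h1 h2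
  · have := Real.cos_sq_add_sin_sq (√κ * r)
    rw [div_pow, Real.sq_sqrt h1.le, mul_div_cancel₀ _ h1.ne']; exact this
  · have h3 : 0 < -κ := by linarith
    have h4 := Real.cosh_sq_sub_sinh_sq (√(-κ) * r)
    have h5 : κ * (Real.sinh (√(-κ) * r) ^ 2 / -κ) = -Real.sinh (√(-κ) * r) ^ 2 := by
      rw [div_neg, mul_neg, mul_div_cancel₀ _ h2.ne]
    rw [div_pow, Real.sq_sqrt h3.le, h5]; linarith
  · have : κ = 0 := by linarith
    simp [this]

theorem hasDerivAt_cosK (κ s t : ℝ) :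
    HasDerivAt (fun t => cosK κ (s * t)) (-κ * s * sinK κ (s * t)) t := by
  have hid : HasDerivAt (fun t : ℝ => s * t) s t := by simpa using (hasDerivAt_id t).const_mul s
  unfold cosK sinK
  split_ifs with h1 h2
  · convert (hid.const_mul √κ).cos using 1
    have h3 := Real.mul_self_sqrt h1.le
    have h0 : √κ ≠ 0 := (Real.sqrt_pos.2 h1).ne'
    rw [neg_mul, neg_mul, neg_mul, mul_div_assoc', neg_inj, div_eq_iff h0]
    linear_combination -s * Real.sin (√κ * (s * t)) * h3
  · convert (hid.const_mul √(-κ)).cosh using 1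
    have h3 := Real.mul_self_sqrt (show 0 ≤ -κ by linarith)
    have h0 : √(-κ) ≠ 0 := (Real.sqrt_pos.2 (by linarith)).ne'
    rw [mul_div_assoc', div_eq_iff h0]
    linear_combination -s * Real.sinh (√(-κ) * (s * t)) * h3
  · have : κ = 0 := by linarith
    simpa [this] using hasDerivAt_const t (1 : ℝ)

theorem hasDerivAt_sinK (κ s t : ℝ) :
    HasDerivAt (fun t => sinK κ (s * t)) (s * cosK κ (s * t)) t := by
  have hid : HasDerivAt (fun t : ℝ => s * t) s t := by simpa using (hasDerivAt_id t).const_mul s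
  unfold cosK sinK
  split_ifs with h1 h2
  · refine ((hid.const_mul √κ).sin.div_const √κ).congr_deriv ?_
    have h0 : √κ ≠ 0 := (Real.sqrt_pos.2 h1).ne'
    rw [div_eq_iff h0]; ring
  · refine ((hid.const_mul √(-κ)).sinh.div_const √(-κ)).congr_deriv ?_
    have h0 : √(-κ) ≠ 0 := (Real.sqrt_pos.2 (by linarith)).ne'
    rw [div_eq_iff h0]; ring
  · simpa using hid

theorem cosK_neg (κ r : ℝ) : cosK κ (-r) = cosK κ r := by simp [cosK]

theorem sinK_neg (κ r : ℝ) : sinK κ (-r) = -sinK κ r := by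
  unfold sinK
  split_ifs <;> simp [neg_div]

theorem cosK_zero (κ : ℝ) : cosK κ 0 = 1 := by simp [cosK]

theorem sinK_zero (κ : ℝ) : sinK κ 0 = 0 := by simp [sinK]

/-- `t ↦ exp_x^κ(t v)` starts at `x` with velocity `v` and, wherever it is defined, satisfies the
geodesic equation of the conformal metric `(λ^κ)² ⟨·, ·⟩`, so that `expMap` is the Riemannian
exponential map. -/
theorem expMap_isGeodesic {d : ℕ} (κ : ℝ) (x v : EuclideanSpace ℝ (Fin d)) (hx : x ∈ st κ d) :
    expMap κ x ((0 : ℝ) • v) = x ∧ expDen κ x ((0 : ℝ) • v) ≠ 0 ∧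
    ∃ w : ℝ → EuclideanSpace ℝ (Fin d), w 0 = v ∧
      ∀ t : ℝ, expDen κ x (t • v) ≠ 0 →
        HasDerivAt (fun t : ℝ => expMap κ x (t • v)) (w t) t ∧
        HasDerivAt w
          ((2 * κ * conf κ (expMap κ x (t • v)) * inner ℝ (expMap κ x (t • v)) (w t)) • w t
            - (κ * conf κ (expMap κ x (t • v)) * ‖w t‖ ^ 2) • expMap κ x (t • v)) t := by
  have hpos : 0 < 1 + κ * ‖x‖ ^ 2 := by
    have : -κ * ‖x‖ ^ 2 < 1 := hx
    linarith
  have hl : conf κ x * (1 + κ * ‖x‖ ^ 2) = 2 := div_mul_cancel₀ _ hpos.ne'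
  have hl0 : conf κ x ≠ 0 := (div_pos two_pos hpos).ne'
  refine ⟨?_, ?_, ?_⟩
  · simp [expMap, expDen, cosK_zero, sinK_zero, hl0]
  · simp [expDen, cosK_zero, sinK_zero, hl0]
  rcases eq_or_ne v 0 with rfl | hv
  · refine ⟨fun _ => 0, rfl, fun t _ => ?_⟩
    simpa using ⟨hasDerivAt_const t _, hasDerivAt_const t _⟩
  obtain ⟨u, hu⟩ : ∃ u, u = ‖v‖⁻¹ • v := ⟨_, rfl⟩
  have hv0 : ‖v‖ ≠ 0 := norm_ne_zero_iff.2 hv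
  have hu1 : inner ℝ u u = 1 := by
    rw [hu, real_inner_self_eq_norm_sq, norm_smul, norm_inv, norm_norm, inv_mul_cancel₀ hv0,
      one_pow]
  obtain ⟨l, hldef⟩ : ∃ l, l = conf κ x := ⟨_, rfl⟩
  obtain ⟨b, hb⟩ : ∃ b, b = inner ℝ x u := ⟨_, rfl⟩
  obtain ⟨s, hs⟩ : ∃ s, s = l * ‖v‖ := ⟨_, rfl⟩
  rw [← hldef] at hl hl0
  let C : ℝ → ℝ := fun t => cosK κ (s * t)
  let S : ℝ → ℝ := fun t => sinK κ (s * t)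
  have hC : ∀ t, HasDerivAt C (-κ * s * S t) t := hasDerivAt_cosK κ s
  have hS : ∀ t, HasDerivAt S (s * C t) t := hasDerivAt_sinK κ s
  let M : ℝ → ℝ := fun t => 1 + (l - 1) * C t - κ * l * b * S t
  let M' : ℝ → ℝ := fun t => (l - 1) * (-κ * s * S t) - κ * l * b * (s * C t)
  let a : ℝ → ℝ := fun t => l * (C t - κ * b * S t)
  let a' : ℝ → ℝ := fun t => l * (-κ * s * S t - κ * b * (s * C t))
  have hM : ∀ t, HasDerivAt M (M' t) t := fun t =>
    (((hC t).const_mul (l - 1)).const_add 1).sub ((hS t).const_mul (κ * l * b))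
  have hM' : ∀ t, HasDerivAt M' (-κ * s ^ 2 * (M t - 1)) t := fun t => by
    refine ((((hS t).const_mul (-κ * s)).const_mul (l - 1)).sub
      (((hC t).const_mul s).const_mul (κ * l * b))).congr_deriv ?_
    simp only [M]; ring
  have ha : ∀ t, HasDerivAt a (a' t) t := fun t =>
    ((hC t).sub ((hS t).const_mul (κ * b))).const_mul l
  have ha' : ∀ t, HasDerivAt a' (-κ * s ^ 2 * a t) t := fun t => by
    refine ((((hS t).const_mul (-κ * s)).sub
      (((hC t).const_mul s).const_mul (κ * b))).const_mul l).congr_deriv ?_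
    simp only [a]; ring
  have hsC : ∀ t, HasDerivAt (fun t => s * C t) (-κ * s ^ 2 * S t) t := fun t => by
    refine ((hC t).const_mul s).congr_deriv ?_
    ring
  have key : ∀ t : ℝ, cosK κ (l * ‖t • v‖) = C t ∧
      sinK κ (l * ‖t • v‖) • (‖t • v‖⁻¹ • t • v) = S t • u ∧
      inner ℝ x (‖t • v‖⁻¹ • t • v) * sinK κ (l * ‖t • v‖) = b * S t := by
    intro t
    have h1 : sinK κ (l * ‖t • v‖) • (‖t • v‖⁻¹ • t • v) = S t • u ∧
        cosK κ (l * ‖t • v‖) = C t := by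
      rcases lt_trichotomy t 0 with ht | rfl | ht
      · have e : l * ‖t • v‖ = -(s * t) := by
          rw [norm_smul, Real.norm_eq_abs, abs_of_neg ht, hs]; ring
        have e2 : ‖t • v‖⁻¹ • t • v = -u := by
          rw [norm_smul, Real.norm_eq_abs, abs_of_neg ht, hu, smul_smul, ← neg_smul]
          congr 1
          rw [mul_inv, mul_right_comm, inv_neg, neg_mul, inv_mul_cancel₀ ht.ne, neg_one_mul]
        rw [e, e2, sinK_neg, cosK_neg]; simp [C, S]
      · simp [C, S, sinK_zero]
      · have e : l * ‖t • v‖ = s * t := by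
          rw [norm_smul, Real.norm_eq_abs, abs_of_pos ht, hs]; ring
        have e2 : ‖t • v‖⁻¹ • t • v = u := by
          rw [norm_smul, Real.norm_eq_abs, abs_of_pos ht, hu, smul_smul]
          congr 1
          rw [mul_inv, mul_right_comm, inv_mul_cancel₀ ht.ne', one_mul]
        rw [e, e2]; simp [C, S]
    refine ⟨h1.2, h1.1, ?_⟩
    have h2 := congrArg (fun y => inner ℝ x y) h1.1
    simp only [inner_smul_right] at h2
    rw [inner_smul_right, inner_smul_right, hb]
    linarith
  have hden : ∀ t : ℝ, expDen κ x (t • v) = M t := by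
    intro t
    obtain ⟨k1, -, k3⟩ := key t
    rw [expDen, ← hldef, k1]
    simp only [M]
    linear_combination (-κ * l) * k3
  have hexp : ∀ t : ℝ, expMap κ x (t • v) = (M t)⁻¹ • (a t • x + S t • u) := by
    intro t
    obtain ⟨k1, k2, k3⟩ := key t
    rw [expMap, hden, ← hldef, k1, k2]
    have h : l * (C t - κ * inner ℝ x (‖t • v‖⁻¹ • t • v) * sinK κ (l * ‖t • v‖)) = a t := by
      simp only [a]
      linear_combination (-κ * l) * k3
    rw [h]
  have hN : ∀ t, HasDerivAt (fun t => a t • x + S t • u) (a' t • x + (s * C t) • u) t := fun t =>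
    ((ha t).smul_const x).add ((hS t).smul_const u)
  have hN' : ∀ t, HasDerivAt (fun t => a' t • x + (s * C t) • u)
      ((-κ * s ^ 2 * a t) • x + (-κ * s ^ 2 * S t) • u) t := fun t =>
    ((ha' t).smul_const x).add ((hsC t).smul_const u)
  refine ⟨fun t => (M t)⁻¹ • (a' t • x + (s * C t) • u)
      + (-M' t / M t ^ 2) • (a t • x + S t • u), ?_, fun t ht => ?_⟩
  · have c0 : C 0 = 1 := by simp [C, cosK_zero]
    have s0 : S 0 = 0 := by simp [S, sinK_zero]
    have hv' : v = ‖v‖ • u := by rw [hu, smul_smul, mul_inv_cancel₀ hv0, one_smul]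
    rw [hv']
    have m0 : M 0 = l := by simp only [M, c0, s0]; ring
    have m0' : M' 0 = -κ * l * b * s := by simp only [M', c0, s0]; ring
    have a0 : a 0 = l := by simp only [a, c0, s0]; ring
    have a0' : a' 0 = -κ * l * b * s := by simp only [a', c0, s0]; ring
    simp only [m0, m0', a0, a0', c0, s0]
    match_scalars
    · field_simp; ring
    · rw [hs]; field_simp; ring
  have hMt : M t ≠ 0 := by rwa [← hden]
  constructor
  · simp only [hexp]
    exact ((hM t).inv hMt).smul (hN t)
  have hCS : C t ^ 2 + κ * S t ^ 2 = 1 := cosK_sq κ (s * t)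
  have hxx : inner ℝ x x = ‖x‖ ^ 2 := real_inner_self_eq_norm_sq x
  have hxu : inner ℝ u x = b := by rw [hb, real_inner_comm]
  obtain ⟨X, hX⟩ : ∃ X, X = ‖x‖ ^ 2 := ⟨_, rfl⟩
  rw [← hX] at hxx hl
  have e1 : M t ^ 2 + κ * (a t ^ 2 * X + 2 * a t * S t * b + S t ^ 2) = 2 * M t := by
    simp only [M, a]; grind
  have e2 : κ * (a t * a' t * X + (a t * s * C t + S t * a' t) * b + S t * s * C t)
      = M' t - M t * M' t := by
    simp only [M, M', a, a']; grind
  have e3 : M t ^ 2 * (a' t ^ 2 * X + 2 * a' t * s * C t * b + s ^ 2 * C t ^ 2)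
      - 2 * M t * M' t * (a t * a' t * X + (a t * s * C t + S t * a' t) * b + S t * s * C t)
      + M' t ^ 2 * (a t ^ 2 * X + 2 * a t * S t * b + S t ^ 2) = s ^ 2 * M t ^ 2 := by
    simp only [M, M', a, a']; grind
  have n1 : κ * ‖expMap κ x (t • v)‖ ^ 2 = 2 / M t - 1 := by
    rw [hexp, ← real_inner_self_eq_norm_sq]
    simp only [inner_add_left, inner_add_right, inner_smul_left, inner_smul_right, hxx, hxu, ← hb,
      hu1, RCLike.conj_to_real]
    field_simp
    linear_combination e1
  have n2 : conf κ (expMap κ x (t • v)) = M t := by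
    rw [conf, n1]; field_simp; ring
  have n3 : κ * inner ℝ (expMap κ x (t • v)) ((M t)⁻¹ • (a' t • x + (s * C t) • u)
      + (-M' t / M t ^ 2) • (a t • x + S t • u)) = -M' t / M t ^ 2 := by
    rw [hexp]
    simp only [inner_add_left, inner_add_right, inner_smul_left, inner_smul_right, hxx, hxu, ← hb,
      hu1, RCLike.conj_to_real]
    field_simp
    linear_combination M t * e2 - M' t * e1
  have n4 : ‖(M t)⁻¹ • (a' t • x + (s * C t) • u)
      + (-M' t / M t ^ 2) • (a t • x + S t • u)‖ ^ 2 = s ^ 2 / M t ^ 2 := by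
    rw [← real_inner_self_eq_norm_sq]
    simp only [inner_add_left, inner_add_right, inner_smul_left, inner_smul_right, hxx, hxu, ← hb,
      hu1, RCLike.conj_to_real]
    field_simp
    linear_combination e3
  have n3' : 2 * κ * M t * inner ℝ (expMap κ x (t • v)) ((M t)⁻¹ • (a' t • x + (s * C t) • u)
      + (-M' t / M t ^ 2) • (a t • x + S t • u)) = -2 * M' t / M t := by
    linear_combination (norm := (field_simp; try ring)) 2 * M t * n3
  simp only [n2, n4]
  rw [n3', hexp]
  refine ((((hM t).inv hMt).smul (hN' t)).add
    (((hM' t).neg.div ((hM t).pow 2) (pow_ne_zero 2 hMt)).smul (hN t))).congr_deriv ?_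
  simp only [Pi.inv_apply, Pi.neg_apply, Pi.pow_apply, Pi.div_apply]
  match_scalars
  · field_simp; ring
  · field_simp; ring

end KStereo

end

namespace KStereo

/-! An isometry preserves the function `chord`, and tangential aggregation is determined by chords.
The norm of `w = (-x) ⊕ y` is the generalized tangent of half the distance, so the distance
determines the chord (`chord_eq_of_kdist_eq`). The chords among `x, y, z` determine the inner
product of `(-x) ⊕ y` and `(-x) ⊕ z` (`inner_add_neg`, in effect the law of cosines), and `(-x) ⊕ y`
is undefined exactly when `κ * chord = 1`.

By the half-angle formulas `exp_x(v) = x ⊕ w` with `w` a multiple of `v` (`expMap_eq_add`). Left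
cancellation then gives `(-x) ⊕ tg = ∑ cᵢ wᵢ`, where `wᵢ = (-x) ⊕ xᵢ` and the `cᵢ` depend only on
the Gram matrix of the `wᵢ` and on the weights. Let `w'ᵢ` and `e` be the images of the `xᵢ` and of
`tg` under `φ`, translated by `-φ(x)`. Then `e` has the norm of `∑ cᵢ wᵢ` and the same inner
products with the `w'ᵢ`, which forces `e = ∑ cᵢ w'ᵢ` (`eq_sum_smul_of_gram_eq`). Hence `φ(tg)` is
the aggregate of the images, with no need to know `φ` elsewhere or to extend it linearly. Where the
half-angle tangent has a pole, both aggregates are antipodes of their base points. -/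

/-- The squared generalized sine of half the distance between two points of the model. -/
noncomputable def chord {d : ℕ} (κ : ℝ) (x y : EuclideanSpace ℝ (Fin d)) : ℝ :=
  ‖x - y‖ ^ 2 / ((1 + κ * ‖x‖ ^ 2) * (1 + κ * ‖y‖ ^ 2))

variable {d : ℕ} {κ : ℝ} {x y z : EuclideanSpace ℝ (Fin d)}

/-! ### Chords and the denominator of the `κ`-addition -/

theorem one_add_pos_of_mem_st (hx : x ∈ st κ d) : 0 < 1 + κ * ‖x‖ ^ 2 := by
  have : -κ * ‖x‖ ^ 2 < 1 := hx
  linarith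

theorem conf_pos (hx : x ∈ st κ d) : 0 < conf κ x :=
  div_pos two_pos (one_add_pos_of_mem_st hx)

theorem neg_mem_st (hx : x ∈ st κ d) : -x ∈ st κ d := by
  have : -κ * ‖x‖ ^ 2 < 1 := hx
  change -κ * ‖-x‖ ^ 2 < 1
  rwa [norm_neg]

theorem addDen_neg_eq (κ : ℝ) (x y : EuclideanSpace ℝ (Fin d)) :
    addDen κ (-x) y = (1 + κ * ‖x‖ ^ 2) * (1 + κ * ‖y‖ ^ 2) - κ * ‖x - y‖ ^ 2 := by
  rw [addDen, norm_neg, inner_neg_left, norm_sub_sq_real]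
  ring

theorem addDen_neg_eq_chord (hx : x ∈ st κ d) (hy : y ∈ st κ d) :
    addDen κ (-x) y
      = (1 + κ * ‖x‖ ^ 2) * (1 + κ * ‖y‖ ^ 2) * (1 - κ * chord κ x y) := by
  have h1 := (one_add_pos_of_mem_st hx).ne'
  have h2 := (one_add_pos_of_mem_st hy).ne'
  rw [addDen_neg_eq, chord]
  field_simp

/-- Definedness of a translate thus depends on the chord alone, and so passes through isometries. -/
theorem addDen_neg_eq_zero_iff (hx : x ∈ st κ d) (hy : y ∈ st κ d) :
    addDen κ (-x) y = 0 ↔ κ * chord κ x y = 1 := by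
  have h1 := (one_add_pos_of_mem_st hx).ne'
  have h2 := (one_add_pos_of_mem_st hy).ne'
  rw [addDen_neg_eq_chord hx hy, mul_eq_zero, sub_eq_zero]
  simp [h1, h2, eq_comm]

/-- By Cauchy–Schwarz the denominator is at least `(1 - |κ| ‖x‖ ‖y‖)²`. -/
theorem addDen_neg_nonneg (κ : ℝ) (x y : EuclideanSpace ℝ (Fin d)) : 0 ≤ addDen κ (-x) y := by
  rw [addDen, norm_neg, inner_neg_left]
  have h : |inner ℝ x y| ≤ ‖x‖ * ‖y‖ := abs_real_inner_le_norm x y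
  have h' : |κ * inner ℝ x y| ≤ |κ| * (‖x‖ * ‖y‖) := by
    rw [abs_mul]; gcongr
  have h2 := neg_abs_le (κ * inner ℝ x y)
  have h3 : κ ^ 2 = |κ| ^ 2 := (sq_abs κ).symm
  rw [h3]
  nlinarith [sq_nonneg (1 - |κ| * (‖x‖ * ‖y‖))]

theorem addDen_pos_of_nonpos (hκ : κ ≤ 0) (hx : x ∈ st κ d) (hy : y ∈ st κ d) :
    0 < addDen κ x y := by
  have h1 := mul_pos (one_add_pos_of_mem_st (neg_mem_st hx)) (one_add_pos_of_mem_st hy)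
  have h2 := addDen_neg_eq κ (-x) y
  rw [neg_neg] at h2
  nlinarith [sq_nonneg ‖-x - y‖]

/-! ### Norms, inner products and left cancellation for the `κ`-addition -/

theorem norm_add_neg_sq (h : addDen κ (-x) y ≠ 0) :
    ‖add κ (-x) y‖ ^ 2 = ‖x - y‖ ^ 2 / addDen κ (-x) y := by
  rw [add, norm_smul, mul_pow, norm_inv, Real.norm_eq_abs, inv_pow, sq_abs, norm_add_sq_real,
    norm_smul, norm_smul, mul_pow, mul_pow, Real.norm_eq_abs, sq_abs, Real.norm_eq_abs, sq_abs,
    inner_smul_left, inner_smul_right, norm_sub_sq_real]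
  simp only [RCLike.conj_to_real]
  field_simp
  simp only [addDen, norm_neg, inner_neg_left]
  ring

theorem one_add_norm_add_neg_sq (h : addDen κ (-x) y ≠ 0) :
    1 + κ * ‖add κ (-x) y‖ ^ 2
      = (1 + κ * ‖x‖ ^ 2) * (1 + κ * ‖y‖ ^ 2) / addDen κ (-x) y := by
  rw [norm_add_neg_sq h, eq_div_iff h, add_mul, mul_assoc, div_mul_cancel₀ _ h, addDen_neg_eq]
  ring

theorem add_neg_mem_st (hx : x ∈ st κ d) (hy : y ∈ st κ d) (h : addDen κ (-x) y ≠ 0) :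
    add κ (-x) y ∈ st κ d := by
  have h1 := one_add_norm_add_neg_sq h
  have h2 : 0 < (1 + κ * ‖x‖ ^ 2) * (1 + κ * ‖y‖ ^ 2) / addDen κ (-x) y :=
    div_pos (mul_pos (one_add_pos_of_mem_st hx) (one_add_pos_of_mem_st hy))
      ((addDen_neg_nonneg κ x y).lt_of_ne' h)
  change -κ * _ < 1
  linarith

theorem add_mem_st (hx : x ∈ st κ d) (hy : y ∈ st κ d) (h : addDen κ x y ≠ 0) :
    add κ x y ∈ st κ d := by
  have := add_neg_mem_st (neg_mem_st hx) hy (by rwa [neg_neg])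
  rwa [neg_neg] at this

/-- The left translation by `-x` preserves the chord, stated as a formula for inner products. -/
theorem inner_add_neg (hx : x ∈ st κ d) (hy : y ∈ st κ d) (hz : z ∈ st κ d)
    (hxy : addDen κ (-x) y ≠ 0) (hxz : addDen κ (-x) z ≠ 0) :
    inner ℝ (add κ (-x) y) (add κ (-x) z)
      = (chord κ x y * (1 - κ * chord κ x z) + chord κ x z * (1 - κ * chord κ x y)
          - chord κ y z) / (2 * (1 - κ * chord κ x y) * (1 - κ * chord κ x z)) := by
  have h1 := (one_add_pos_of_mem_st hx).ne'
  have h2 := (one_add_pos_of_mem_st hy).ne'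
  have h3 := (one_add_pos_of_mem_st hz).ne'
  have ey : 1 - κ * chord κ x y
      = addDen κ (-x) y / ((1 + κ * ‖x‖ ^ 2) * (1 + κ * ‖y‖ ^ 2)) := by
    rw [addDen_neg_eq_chord hx hy]; field_simp
  have ez : 1 - κ * chord κ x z
      = addDen κ (-x) z / ((1 + κ * ‖x‖ ^ 2) * (1 + κ * ‖z‖ ^ 2)) := by
    rw [addDen_neg_eq_chord hx hz]; field_simp
  -- Polarization with denominators cleared: the last term encodes `‖w_y - w_z‖²` for the translates
  -- `w_y`, `w_z` of `y`, `z`.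
  have key : 2 * inner ℝ
        ((1 - 2 * κ * inner ℝ (-x) y - κ * ‖y‖ ^ 2) • (-x) + (1 + κ * ‖-x‖ ^ 2) • y)
        ((1 - 2 * κ * inner ℝ (-x) z - κ * ‖z‖ ^ 2) • (-x) + (1 + κ * ‖-x‖ ^ 2) • z)
      = ‖x - y‖ ^ 2 * addDen κ (-x) z + ‖x - z‖ ^ 2 * addDen κ (-x) y
        - (1 + κ * ‖x‖ ^ 2) ^ 2 * ‖y - z‖ ^ 2 := by
    simp only [addDen, norm_sub_sq_real, inner_add_left, inner_add_right, inner_smul_left,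
      inner_smul_right, inner_neg_left, inner_neg_right, norm_neg, RCLike.conj_to_real,
      real_inner_self_eq_norm_sq, real_inner_comm x y]
    ring
  rw [ey, ez, add, add, inner_smul_left, inner_smul_right, RCLike.conj_to_real,
    eq_div_iff (by positivity)]
  simp only [chord]
  field_simp
  linear_combination key

/-- The denominator is recorded along with the cancellation law, since its nonvanishing is what
transfers definedness of the exponential. -/
theorem add_add_neg (hx : 1 + κ * ‖x‖ ^ 2 ≠ 0) (h : addDen κ (-x) y ≠ 0) :
    addDen κ x (add κ (-x) y) = (1 + κ * ‖x‖ ^ 2) ^ 2 / addDen κ (-x) y ∧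
      add κ x (add κ (-x) y) = y := by
  have hn := norm_add_neg_sq h
  have hi : inner ℝ x (add κ (-x) y)
      = (-(1 + 2 * κ * inner ℝ x y - κ * ‖y‖ ^ 2) * ‖x‖ ^ 2
          + (1 + κ * ‖x‖ ^ 2) * inner ℝ x y) / addDen κ (-x) y := by
    simp only [add, inner_smul_right, inner_add_right, inner_neg_left, inner_neg_right, norm_neg,
      real_inner_self_eq_norm_sq]
    field_simp
    ring
  have hD : addDen κ (-x) y = 1 + 2 * κ * inner ℝ x y + κ ^ 2 * ‖x‖ ^ 2 * ‖y‖ ^ 2 := by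
    rw [addDen, norm_neg, inner_neg_left]; ring
  have h1 : addDen κ x (add κ (-x) y) = (1 + κ * ‖x‖ ^ 2) ^ 2 / addDen κ (-x) y := by
    rw [addDen, hn, hi, eq_div_iff h, norm_sub_sq_real]
    field_simp
    rw [hD]
    ring
  refine ⟨h1, ?_⟩
  have h2 : 1 - 2 * κ * inner ℝ x (add κ (-x) y) - κ * ‖add κ (-x) y‖ ^ 2
      = (1 + κ * ‖x‖ ^ 2) * (1 + 2 * κ * inner ℝ x y - κ * ‖y‖ ^ 2) / addDen κ (-x) y := by
    rw [hn, hi, eq_div_iff h, norm_sub_sq_real]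
    field_simp
    rw [hD]
    ring
  rw [add, h1, h2, add, inner_neg_left, norm_neg]
  match_scalars
  · field_simp
    ring
  · field_simp

theorem add_neg_add (hx : 1 + κ * ‖x‖ ^ 2 ≠ 0) (h : addDen κ x y ≠ 0) :
    addDen κ (-x) (add κ x y) = (1 + κ * ‖x‖ ^ 2) ^ 2 / addDen κ x y ∧
      add κ (-x) (add κ x y) = y := by
  have := add_add_neg (κ := κ) (x := -x) (y := y) (by rwa [norm_neg]) (by rwa [neg_neg])
  rwa [neg_neg, norm_neg] at this

/-! ### The distance determines the chord -/

theorem arctanK_injOn {a b : ℝ} (ha : 0 < 1 + κ * a ^ 2) (hb : 0 < 1 + κ * b ^ 2)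
    (h : arctanK κ a = arctanK κ b) : a = b := by
  unfold arctanK at h
  split_ifs at h with h1 h2
  · have h0 := Real.sqrt_pos.2 h1
    rw [div_left_inj' h0.ne'] at h
    exact mul_left_cancel₀ h0.ne' (Real.arctan_injective h)
  · have h0 : 0 < √(-κ) := Real.sqrt_pos.2 (by linarith)
    have hs : √(-κ) ^ 2 = -κ := Real.sq_sqrt (by linarith)
    rw [div_left_inj' h0.ne'] at h
    -- The positivity hypotheses keep the arguments in `(-1, 1)`, where `artanh` is injective.
    have mem : ∀ c : ℝ, 0 < 1 + κ * c ^ 2 → √(-κ) * c ∈ Set.Ioo (-1 : ℝ) 1 := fun c hc =>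
      abs_lt.1 ((sq_lt_one_iff_abs_lt_one _).1 (by rw [mul_pow, hs]; linarith))
    exact mul_left_cancel₀ h0.ne' (Real.artanh_injOn (mem a ha) (mem b hb) h)
  · exact h

theorem kdist_lt_pi (hκ : 0 < κ) (h : addDen κ (-x) y ≠ 0) : kdist κ x y < Real.pi / √κ := by
  have h0 := Real.sqrt_pos.2 hκ
  rw [kdist, if_neg h, arctanK, if_pos hκ, mul_div_assoc', div_lt_div_iff_of_pos_right h0]
  linarith [Real.arctan_lt_pi_div_two (√κ * ‖add κ (-x) y‖)]

theorem pos_of_addDen_eq_zero (hx : x ∈ st κ d) (hy : y ∈ st κ d) (h : addDen κ (-x) y = 0) :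
    0 < κ := by
  by_contra hκ
  exact (addDen_pos_of_nonpos (not_lt.1 hκ) (neg_mem_st hx) hy).ne' h

/-- This is `sin² = tan² / (1 + κ tan²)` at half the distance. -/
theorem chord_eq_of_addDen_ne_zero (hx : x ∈ st κ d) (hy : y ∈ st κ d)
    (h : addDen κ (-x) y ≠ 0) :
    chord κ x y = ‖add κ (-x) y‖ ^ 2 / (1 + κ * ‖add κ (-x) y‖ ^ 2) := by
  have h1 := (one_add_pos_of_mem_st hx).ne'
  have h2 := (one_add_pos_of_mem_st hy).ne'
  rw [one_add_norm_add_neg_sq h, norm_add_neg_sq h, chord]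
  field_simp

/-- The value `π / √κ` is taken only by antipodal pairs, where `κ * chord = 1`; on all other pairs
injectivity of `arctanK` recovers the norm of the translate. -/
theorem chord_eq_of_kdist_eq {x' y' : EuclideanSpace ℝ (Fin d)}
    (hx : x ∈ st κ d) (hy : y ∈ st κ d) (hx' : x' ∈ st κ d) (hy' : y' ∈ st κ d)
    (h : kdist κ x' y' = kdist κ x y) : chord κ x' y' = chord κ x y := by
  have zero : ∀ {a b : EuclideanSpace ℝ (Fin d)}, addDen κ (-a) b = 0 →
      kdist κ a b = Real.pi / √κ := fun h => by rw [kdist, if_pos h]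
  by_cases h0 : addDen κ (-x) y = 0
  · have hκ := pos_of_addDen_eq_zero hx hy h0
    have h0' : addDen κ (-x') y' = 0 := by
      by_contra h1
      exact (kdist_lt_pi hκ h1).ne (h.trans (zero h0))
    rw [addDen_neg_eq_zero_iff hx hy] at h0
    rw [addDen_neg_eq_zero_iff hx' hy'] at h0'
    exact mul_left_cancel₀ hκ.ne' (h0'.trans h0.symm)
  · have h0' : addDen κ (-x') y' ≠ 0 := fun h1 =>
      (kdist_lt_pi (pos_of_addDen_eq_zero hx' hy' h1) h0).ne (h.symm.trans (zero h1))
    rw [kdist, if_neg h0', kdist, if_neg h0] at h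
    have e := arctanK_injOn (one_add_pos_of_mem_st (add_neg_mem_st hx' hy' h0'))
      (one_add_pos_of_mem_st (add_neg_mem_st hx hy h0)) (mul_left_cancel₀ two_ne_zero h)
    rw [chord_eq_of_addDen_ne_zero hx hy h0, chord_eq_of_addDen_ne_zero hx' hy' h0', e]

/-! ### The exponential map as a `κ`-translation -/

theorem cosK_two_mul (κ r : ℝ) : cosK κ (2 * r) = cosK κ r ^ 2 - κ * sinK κ r ^ 2 := by
  unfold cosK sinK
  split_ifs with h1 h2
  · rw [div_pow, Real.sq_sqrt h1.le, mul_div_cancel₀ _ h1.ne', mul_left_comm, Real.cos_two_mul']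
  · have h3 : 0 < -κ := by linarith
    have h5 : κ * (Real.sinh (√(-κ) * r) ^ 2 / -κ) = -Real.sinh (√(-κ) * r) ^ 2 := by
      rw [div_neg, mul_neg, mul_div_cancel₀ _ h2.ne]
    rw [div_pow, Real.sq_sqrt h3.le, h5, mul_left_comm, Real.cosh_two_mul]
    ring
  · have : κ = 0 := by linarith
    simp [this]

theorem sinK_two_mul (κ r : ℝ) : sinK κ (2 * r) = 2 * sinK κ r * cosK κ r := by
  unfold cosK sinK
  split_ifs
  · rw [mul_left_comm, Real.sin_two_mul]; ring
  · rw [mul_left_comm, Real.sinh_two_mul]; ring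
  · ring

theorem cosK_pos_of_nonpos (hκ : κ ≤ 0) (r : ℝ) : 0 < cosK κ r := by
  rw [cosK, if_neg hκ.not_gt]
  split_ifs
  · exact Real.cosh_pos _
  · exact one_pos

/-- The generalized tangent. -/
noncomputable def tanK (κ r : ℝ) : ℝ := sinK κ r / cosK κ r

theorem one_add_tanK_sq {r : ℝ} (hr : cosK κ r ≠ 0) : 1 + κ * tanK κ r ^ 2 = (cosK κ r ^ 2)⁻¹ := by
  have := cosK_sq κ r
  rw [tanK]
  field_simp
  linarith

/-- The point `w` with `exp_x^κ(v) = x ⊕_κ w`. -/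
noncomputable def expShift (κ : ℝ) (x v : EuclideanSpace ℝ (Fin d)) : EuclideanSpace ℝ (Fin d) :=
  (tanK κ (conf κ x * ‖v‖ / 2) * ‖v‖⁻¹) • v

theorem norm_expShift_sq (κ : ℝ) (x v : EuclideanSpace ℝ (Fin d)) :
    ‖expShift κ x v‖ ^ 2 = tanK κ (conf κ x * ‖v‖ / 2) ^ 2 := by
  rcases eq_or_ne v 0 with rfl | hv
  · simp [expShift, tanK, sinK_zero]
  · have : ‖v‖ ≠ 0 := norm_ne_zero_iff.2 hv
    rw [expShift, norm_smul, mul_pow, Real.norm_eq_abs, sq_abs]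
    field_simp

theorem expShift_mem_st {v : EuclideanSpace ℝ (Fin d)} (h : cosK κ (conf κ x * ‖v‖ / 2) ≠ 0) :
    expShift κ x v ∈ st κ d := by
  have h1 := one_add_tanK_sq h
  rw [← norm_expShift_sq] at h1
  have h2 : 0 < (cosK κ (conf κ x * ‖v‖ / 2) ^ 2)⁻¹ := by positivity
  change -κ * _ < 1
  linarith

/-- Write cosine and sine of `λ‖v‖` through the half angle and cancel `λ cos²` from numerator and
denominator. At `v = 0` the convention `‖0‖⁻¹ = 0` makes both sides agree. -/
theorem expMap_eq_add {v : EuclideanSpace ℝ (Fin d)} (hx : x ∈ st κ d)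
    (h : cosK κ (conf κ x * ‖v‖ / 2) ≠ 0) :
    expDen κ x v = conf κ x * cosK κ (conf κ x * ‖v‖ / 2) ^ 2 * addDen κ x (expShift κ x v) ∧
      expMap κ x v = add κ x (expShift κ x v) := by
  have hp := (one_add_pos_of_mem_st hx).ne'
  have hl : conf κ x * (1 + κ * ‖x‖ ^ 2) = 2 := div_mul_cancel₀ _ hp
  have hl0 := (conf_pos hx).ne'
  have hn := norm_expShift_sq κ x v
  have hi : inner ℝ x (expShift κ x v)
      = tanK κ (conf κ x * ‖v‖ / 2) * inner ℝ x (‖v‖⁻¹ • v) := by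
    rw [expShift, inner_smul_right, inner_smul_right, mul_assoc]
  have hv : expShift κ x v = tanK κ (conf κ x * ‖v‖ / 2) • (‖v‖⁻¹ • v) := by
    rw [expShift, smul_smul]
  have hr : conf κ x * ‖v‖ = 2 * (conf κ x * ‖v‖ / 2) := by ring
  have hcs := cosK_sq κ (conf κ x * ‖v‖ / 2)
  have hC := cosK_two_mul κ (conf κ x * ‖v‖ / 2)
  have hS := sinK_two_mul κ (conf κ x * ‖v‖ / 2)
  rw [← hr] at hC hS
  have hden : expDen κ x v
      = conf κ x * cosK κ (conf κ x * ‖v‖ / 2) ^ 2 * addDen κ x (expShift κ x v) := by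
    rw [expDen, addDen, hn, hi, hC, hS, tanK]
    generalize cosK κ (conf κ x * ‖v‖ / 2) = c at *
    generalize sinK κ (conf κ x * ‖v‖ / 2) = s at *
    generalize conf κ x = l at *
    field_simp
    linear_combination (-1) * hcs - κ * s ^ 2 * hl
  refine ⟨hden, ?_⟩
  rw [expMap, add, hden, hn, hi, hC, hS, hv]
  generalize addDen κ x (tanK κ (conf κ x * ‖v‖ / 2) • (‖v‖⁻¹ • v)) = D at *
  rw [tanK]
  generalize ‖v‖⁻¹ • v = u at *
  generalize cosK κ (conf κ x * ‖v‖ / 2) = c at *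
  generalize sinK κ (conf κ x * ‖v‖ / 2) = s at *
  generalize conf κ x = l at *
  rw [mul_inv, mul_comm _ D⁻¹, mul_smul]
  congr 1
  match_scalars
  · field_simp
    ring
  · field_simp
    linear_combination -s * hl

theorem expDen_ne_zero_iff {v : EuclideanSpace ℝ (Fin d)} (hx : x ∈ st κ d)
    (h : cosK κ (conf κ x * ‖v‖ / 2) ≠ 0) :
    expDen κ x v ≠ 0 ↔ addDen κ x (expShift κ x v) ≠ 0 := by
  have := (conf_pos hx).ne'
  rw [(expMap_eq_add hx h).1]
  simp [h, this]

/-! ### Antipodal points -/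

/-- After half a great circle the exponential map arrives at the antipode. -/
theorem expMap_of_cosK_eq_zero {v : EuclideanSpace ℝ (Fin d)} (hx : x ∈ st κ d)
    (h : cosK κ (conf κ x * ‖v‖ / 2) = 0) :
    expDen κ x v = conf κ x * (κ * ‖x‖ ^ 2) ∧ expMap κ x v = -(κ * ‖x‖ ^ 2)⁻¹ • x := by
  have hp := (one_add_pos_of_mem_st hx).ne'
  have hl : conf κ x * (1 + κ * ‖x‖ ^ 2) = 2 := div_mul_cancel₀ _ hp
  have hl0 := (conf_pos hx).ne'
  have hr : conf κ x * ‖v‖ = 2 * (conf κ x * ‖v‖ / 2) := by ring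
  have hcs := cosK_sq κ (conf κ x * ‖v‖ / 2)
  have hC := cosK_two_mul κ (conf κ x * ‖v‖ / 2)
  have hS := sinK_two_mul κ (conf κ x * ‖v‖ / 2)
  rw [← hr] at hC hS
  have hC' : cosK κ (conf κ x * ‖v‖) = -1 := by rw [hC]; rw [h] at hcs ⊢; linarith
  have hS' : sinK κ (conf κ x * ‖v‖) = 0 := by rw [hS, h, mul_zero]
  have hden : expDen κ x v = conf κ x * (κ * ‖x‖ ^ 2) := by
    rw [expDen, hC', hS']
    linear_combination -hl
  refine ⟨hden, ?_⟩
  rw [expMap, hden, hC', hS', mul_zero, sub_zero, zero_smul, add_zero, smul_smul, mul_inv]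
  congr 1
  field_simp

theorem eq_antipode_of_addDen_eq_zero (h : addDen κ (-x) y = 0) :
    κ * ‖x‖ ^ 2 ≠ 0 ∧ y = -(κ * ‖x‖ ^ 2)⁻¹ • x := by
  rw [addDen, norm_neg, inner_neg_left] at h
  have hx : κ * ‖x‖ ^ 2 ≠ 0 := by
    intro h0
    rcases mul_eq_zero.1 h0 with h1 | h1
    · simp [h1] at h
    · have : x = 0 := by simpa using h1
      simp [this] at h
  refine ⟨hx, ?_⟩
  -- This squared norm is `‖x‖²` times the denominator.
  have h2 : ‖(κ * ‖x‖ ^ 2) • y + x‖ ^ 2 = 0 := by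
    rw [norm_add_sq_real, norm_smul, mul_pow, Real.norm_eq_abs, sq_abs, inner_smul_left,
      RCLike.conj_to_real, real_inner_comm]
    linear_combination ‖x‖ ^ 2 * h
  have h3 : (κ * ‖x‖ ^ 2) • y = -x := eq_neg_of_add_eq_zero_left (by simpa using h2)
  rw [neg_smul, ← smul_neg, ← h3, smul_smul, inv_mul_cancel₀ hx, one_smul]

theorem addDen_neg_antipode (h : κ * ‖x‖ ^ 2 ≠ 0) :
    addDen κ (-x) (-(κ * ‖x‖ ^ 2)⁻¹ • x) = 0 := by
  have h1 : κ ≠ 0 := left_ne_zero_of_mul h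
  have h2 : ‖x‖ ≠ 0 := fun h0 => h (by simp [h0])
  rw [addDen, norm_neg, inner_neg_left, inner_smul_right, norm_smul, mul_pow, Real.norm_eq_abs,
    sq_abs, real_inner_self_eq_norm_sq]
  field_simp
  ring

/-! ### Vectors with equal Gram matrices -/

theorem norm_sum_smul_of_gram_eq {ι : Type*} [Fintype ι] {E F : Type*} [NormedAddCommGroup E]
    [InnerProductSpace ℝ E] [NormedAddCommGroup F] [InnerProductSpace ℝ F] {w : ι → E} {w' : ι → F}
    (h : ∀ i j, inner ℝ (w' i) (w' j) = inner ℝ (w i) (w j)) (c : ι → ℝ) :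
    ‖∑ i, c i • w' i‖ = ‖∑ i, c i • w i‖ := by
  rw [← sq_eq_sq₀ (norm_nonneg _) (norm_nonneg _), ← real_inner_self_eq_norm_sq,
    ← real_inner_self_eq_norm_sq]
  simp only [sum_inner, inner_sum, inner_smul_left, inner_smul_right, h]

/-- Expanding `‖e - ∑ cᵢ w'ᵢ‖²` gives zero. The norm condition replaces any assumption that `e` lies
in the span of the `w'ᵢ`. -/
theorem eq_sum_smul_of_gram_eq {ι : Type*} [Fintype ι] {E F : Type*} [NormedAddCommGroup E]
    [InnerProductSpace ℝ E] [NormedAddCommGroup F] [InnerProductSpace ℝ F] {w : ι → E} {w' : ι → F}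
    (h : ∀ i j, inner ℝ (w' i) (w' j) = inner ℝ (w i) (w j)) (c : ι → ℝ) {e : F}
    (h1 : ∀ i, inner ℝ e (w' i) = inner ℝ (∑ j, c j • w j) (w i))
    (h2 : ‖e‖ = ‖∑ j, c j • w j‖) : e = ∑ i, c i • w' i := by
  have h3 : inner ℝ e (∑ i, c i • w' i) = ‖∑ i, c i • w i‖ ^ 2 := by
    rw [← real_inner_self_eq_norm_sq (∑ i, c i • w i), inner_sum, inner_sum]
    simp only [inner_smul_right, h1]
  have h4 : ‖e - ∑ i, c i • w' i‖ ^ 2 = 0 := by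
    rw [norm_sub_sq_real, h3, norm_sum_smul_of_gram_eq h, h2]
    ring
  exact sub_eq_zero.1 (by simpa using h4)

/-! ### Aggregation through translated points -/

/-- `∑ αᵢ (2 arctanK ‖wᵢ‖ / ‖wᵢ‖) wᵢ` with `wᵢ = (-x) ⊕_κ xᵢ`, the aggregated tangent vector rescaled
to Riemannian length. -/
theorem conf_smul_tgVec {n : ℕ} (hx : x ∈ st κ d) (xs : Fin n → EuclideanSpace ℝ (Fin d))
    (α : Fin n → ℝ) :
    conf κ x • tgVec κ x xs α = ∑ i, (α i * (2 * arctanK κ ‖add κ (-x) (xs i)‖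
      * ‖add κ (-x) (xs i)‖⁻¹)) • add κ (-x) (xs i) := by
  have := (conf_pos hx).ne'
  rw [tgVec, Finset.smul_sum]
  refine Finset.sum_congr rfl fun i _ => ?_
  rw [logMap, smul_smul, smul_smul, smul_smul]
  congr 1
  field_simp

/-- In terms of the rescaled vector `λ v` the coefficient no longer involves the base point, so it
can be compared at `x` and `x'`. -/
theorem expShift_eq {v : EuclideanSpace ℝ (Fin d)} (hx : x ∈ st κ d) :
    expShift κ x v = (tanK κ (‖conf κ x • v‖ / 2) * ‖conf κ x • v‖⁻¹) • (conf κ x • v) := by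
  have h := conf_pos hx
  rw [norm_smul, Real.norm_of_nonneg h.le, expShift, smul_smul, mul_inv]
  congr 1
  field_simp

theorem tgDefined_of_nonpos {n : ℕ} (hκ : κ ≤ 0) (hx : x ∈ st κ d)
    {xs : Fin n → EuclideanSpace ℝ (Fin d)} (hxs : ∀ i, xs i ∈ st κ d) (α : Fin n → ℝ) :
    TgDefined κ x xs α ∧ tg κ x xs α ∈ st κ d := by
  have hc := (cosK_pos_of_nonpos hκ (conf κ x * ‖tgVec κ x xs α‖ / 2)).ne'
  have hm := expShift_mem_st hc
  have hD := (addDen_pos_of_nonpos hκ hx hm).ne'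
  refine ⟨⟨fun i => (addDen_pos_of_nonpos hκ (neg_mem_st hx) (hxs i)).ne',
    (expDen_ne_zero_iff hx hc).2 hD⟩, ?_⟩
  rw [tg, (expMap_eq_add hx hc).2]
  exact add_mem_st hx hm hD

/-- Tangential aggregation depends on the chords between the points only: a point `z'` which has
the chords of the aggregate is the aggregate. -/
theorem tg_eq_of_chord_eq {n : ℕ} {x' z' : EuclideanSpace ℝ (Fin d)}
    {xs xs' : Fin n → EuclideanSpace ℝ (Fin d)} {α : Fin n → ℝ}
    (hx : x ∈ st κ d) (hx' : x' ∈ st κ d) (hxs : ∀ i, xs i ∈ st κ d)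
    (hxs' : ∀ i, xs' i ∈ st κ d) (hz : tg κ x xs α ∈ st κ d) (hz' : z' ∈ st κ d)
    (hdef : TgDefined κ x xs α)
    (c1 : ∀ i, chord κ x' (xs' i) = chord κ x (xs i))
    (c2 : ∀ i j, chord κ (xs' i) (xs' j) = chord κ (xs i) (xs j))
    (c3 : chord κ x' z' = chord κ x (tg κ x xs α))
    (c4 : ∀ i, chord κ z' (xs' i) = chord κ (tg κ x xs α) (xs i)) :
    TgDefined κ x' xs' α ∧ tg κ x' xs' α = z' := by
  obtain ⟨hD, hE⟩ := hdef
  have hD' : ∀ i, addDen κ (-x') (xs' i) ≠ 0 := fun i => by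
    rw [Ne, addDen_neg_eq_zero_iff hx' (hxs' i), c1, ← addDen_neg_eq_zero_iff hx (hxs i)]
    exact hD i
  have gram : ∀ i j, inner ℝ (add κ (-x') (xs' i)) (add κ (-x') (xs' j))
      = inner ℝ (add κ (-x) (xs i)) (add κ (-x) (xs j)) := fun i j => by
    rw [inner_add_neg hx' (hxs' i) (hxs' j) (hD' i) (hD' j),
      inner_add_neg hx (hxs i) (hxs j) (hD i) (hD j), c1, c1, c2]
  have hnorm : ∀ i, ‖add κ (-x') (xs' i)‖ = ‖add κ (-x) (xs i)‖ := fun i => by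
    rw [norm_eq_sqrt_real_inner, gram, ← norm_eq_sqrt_real_inner]
  -- The coefficients involve only the weights and the norms of the translates, so one family `b`
  -- serves both base points.
  obtain ⟨b, hV, hV'⟩ : ∃ b : Fin n → ℝ,
      conf κ x • tgVec κ x xs α = ∑ i, b i • add κ (-x) (xs i) ∧
      conf κ x' • tgVec κ x' xs' α = ∑ i, b i • add κ (-x') (xs' i) := by
    refine ⟨_, conf_smul_tgVec hx xs α, ?_⟩
    rw [conf_smul_tgVec hx']
    simp only [hnorm]
  have hr : ‖conf κ x' • tgVec κ x' xs' α‖ = ‖conf κ x • tgVec κ x xs α‖ := by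
    rw [hV, hV', norm_sum_smul_of_gram_eq gram]
  have hr' : conf κ x' * ‖tgVec κ x' xs' α‖ = conf κ x * ‖tgVec κ x xs α‖ := by
    rwa [norm_smul, norm_smul, Real.norm_of_nonneg (conf_pos hx).le,
      Real.norm_of_nonneg (conf_pos hx').le] at hr
  have hp := (one_add_pos_of_mem_st hx).ne'
  have hp' := (one_add_pos_of_mem_st hx').ne'
  -- Here the half-angle tangent has a pole and the aggregate is the antipode of `x`; equal chords
  -- make `z'` the antipode of `x'`, which is unique.
  by_cases hc : cosK κ (conf κ x * ‖tgVec κ x xs α‖ / 2) = 0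
  · have hc' : cosK κ (conf κ x' * ‖tgVec κ x' xs' α‖ / 2) = 0 := by rwa [hr']
    obtain ⟨e1, e2⟩ := expMap_of_cosK_eq_zero hx hc
    obtain ⟨e1', e2'⟩ := expMap_of_cosK_eq_zero hx' hc'
    have h0 : addDen κ (-x) (tg κ x xs α) = 0 := by
      rw [tg, e2]
      exact addDen_neg_antipode fun h => hE (by rw [e1, h, mul_zero])
    have h0' : addDen κ (-x') z' = 0 := by
      rwa [addDen_neg_eq_zero_iff hx' hz', c3, ← addDen_neg_eq_zero_iff hx hz]
    obtain ⟨h1, h2⟩ := eq_antipode_of_addDen_eq_zero h0'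
    exact ⟨⟨hD', by rw [e1']; exact mul_ne_zero (conf_pos hx').ne' h1⟩, by rw [tg, e2', h2]⟩
  · have hc' : cosK κ (conf κ x' * ‖tgVec κ x' xs' α‖ / 2) ≠ 0 := by rwa [hr']
    have hA := (expDen_ne_zero_iff hx hc).1 hE
    have e2 : tg κ x xs α = _ := (expMap_eq_add hx hc).2
    obtain ⟨f1, f2⟩ := add_neg_add hp hA
    rw [← e2] at f1 f2
    have hDz : addDen κ (-x) (tg κ x xs α) ≠ 0 := by
      rw [f1]; exact div_ne_zero (pow_ne_zero 2 hp) hA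
    have hDz' : addDen κ (-x') z' ≠ 0 := by
      rwa [Ne, addDen_neg_eq_zero_iff hx' hz', c3, ← addDen_neg_eq_zero_iff hx hz]
    have g : add κ (-x') z' = expShift κ x' (tgVec κ x' xs' α) := by
      rw [expShift_eq hx', hr, hV', Finset.smul_sum]
      simp only [smul_smul]
      -- The final `← hV` folds the sum back inside the norms, so that the coefficients match those
      -- of the goal.
      rw [expShift_eq hx, hV, Finset.smul_sum, ← hV] at f2
      simp only [smul_smul] at f2
      refine eq_sum_smul_of_gram_eq gram _ (fun i => ?_) ?_
      · rw [← f2, inner_add_neg hx' hz' (hxs' i) hDz' (hD' i),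
          inner_add_neg hx hz (hxs i) hDz (hD i), c1, c3, c4]
      -- The norm is the case of equal arguments in `inner_add_neg`, where the third chord vanishes.
      · have self : ∀ a : EuclideanSpace ℝ (Fin d), chord κ a a = 0 := fun a => by simp [chord]
        rw [← f2, norm_eq_sqrt_real_inner, norm_eq_sqrt_real_inner,
          inner_add_neg hx' hz' hz' hDz' hDz', inner_add_neg hx hz hz hDz hDz, c3, self, self]
    obtain ⟨k1, k2⟩ := add_add_neg hp' hDz'
    rw [g] at k1 k2
    refine ⟨⟨hD', (expDen_ne_zero_iff hx' hc').2 ?_⟩, ?_⟩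
    · rw [k1]; exact div_ne_zero (pow_ne_zero 2 hp') hDz'
    · rw [tg, (expMap_eq_add hx' hc').2, k2]

end KStereo

theorem theorem6 (κ : ℝ) (d n : ℕ)
    (S : Set (EuclideanSpace ℝ (Fin d)))
    (φ : EuclideanSpace ℝ (Fin d) → EuclideanSpace ℝ (Fin d))
    (hφ : KStereo.IsIsom κ S φ)
    (x : EuclideanSpace ℝ (Fin d)) (hx : x ∈ S)
    (xs : Fin n → EuclideanSpace ℝ (Fin d)) (hxs : ∀ i, xs i ∈ S)
    (α : Fin n → ℝ)
    (hdef : 0 < κ → KStereo.TgDefined κ x xs α ∧ KStereo.tg κ x xs α ∈ S) :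
    (KStereo.TgDefined κ x xs α ∧ KStereo.tg κ x xs α ∈ S) ∧
      KStereo.TgDefined κ (φ x) (fun i => φ (xs i)) α ∧
      KStereo.tg κ (φ x) (fun i => φ (xs i)) α = φ (KStereo.tg κ x xs α) := by
  have hS : KStereo.TgDefined κ x xs α ∧ KStereo.tg κ x xs α ∈ S := by
    rcases lt_or_ge 0 κ with hκ | hκ
    · exact hdef hκ
    · have := KStereo.tgDefined_of_nonpos hκ (hφ.subset hx) (fun i => hφ.subset (hxs i)) α
      rwa [← hφ.whole hκ] at this
  have hchord : ∀ a ∈ S, ∀ b ∈ S, KStereo.chord κ (φ a) (φ b) = KStereo.chord κ a b :=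
    fun a ha b hb => KStereo.chord_eq_of_kdist_eq (hφ.subset ha) (hφ.subset hb) (hφ.mapsTo ha)
      (hφ.mapsTo hb) (hφ.dist_eq a ha b hb)
  -- The candidate `z'` is the image under `φ` of the aggregate, which lies in the domain `S`.
  exact ⟨hS, KStereo.tg_eq_of_chord_eq (hφ.subset hx) (hφ.mapsTo hx)
    (fun i => hφ.subset (hxs i)) (fun i => hφ.mapsTo (hxs i)) (hφ.subset hS.2)
    (hφ.mapsTo hS.2) hS.1 (fun i => hchord _ hx _ (hxs i))
    (fun i j => hchord _ (hxs i) _ (hxs j)) (hchord _ hx _ hS.2)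
    (fun i => hchord _ hS.2 _ (hxs i))⟩
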